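/- **Algebraic theories.** An algebraic theory $A$ consists of a set of operation symbols with finite arities and a set $E_A$ of equations, i.e. pairs of terms in a finite variable context. An equation $s=t$ between $A$-terms in $m$ variables is *valid in $A$* if $(s,t)$ lies in the smallest congruence relation containing all substitution instances of the equations in $E_A$. It is *balanced* if $s$ and $t$ contain the same variables and each of these variables occurs equally many times in $s$ and in $t$. **Multi-clocked guarded recursion.** Types are understood in the standard presheaf model. A time object $(E,\delta)$ is a finite set $E$ of clock names with a function $\delta:E\to\mathbb N$ (the number of ticks left on each clock). A morphism $(E,\delta)\to(E',\delta')$ is a map $\sigma:E\to E'$ with $\delta'(\sigma(\lambda))\le\delta(\lambda)$ for all $\lambda \in E$. A context $\Gamma$ is a covariant set-valued functor on time objects. A clock $\kappa$ in $\Gamma$ is a natural choice of an element $\kappa(\gamma)\in E$ for each $\gamma\in\Gamma(E,\delta)$. A type $X$ over $\Gamma$ is a covariant set-valued functor on the category of elements of $\Gamma$, whose objects $c=(E,\delta,\gamma)$ are called stages, and maps between types are natural transformations. For a stage $c$ with $\delta(\kappa(\gamma))>0$ let $c^-$ be the stage obtained by lowering $\delta(\kappa(\gamma))$ by one and restricting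 $\gamma$ along the evident morphism $c\to c^-$. The type $\triangleright^\kappa X$ is given by $(\triangleright^\kappa X)(c)=X(c^-)$ if $\delta(\kappa(\gamma))>0$, and is a singleton at $c$ otherwise. The guarded delay type $D^\kappa X$ is the guarded recursive type $$D^\kappa X\;\simeq\; X+\triangleright^\kappa (D^\kappa X),$$ with inclusions $\mathsf{now}:X\to D^\kappa X$ and $\mathsf{step}:\triangleright^\kappa(D^\kappa X)\to D^\kappa X$. Below, "one tick later" indicates the stage $c^-$: there, $u:\triangleright^\kappa Y$ yields an element $u'$ of $Y$, and elements already present are restricted along $c\to c^-$. **Sequential lifting.** A model of $A$ over $\Gamma$ is a type $X$ over $\Gamma$ with a map $\mathsf{op}_X:X^n\to X$ for each $n$-ary operation symbol $\mathsf{op}$, such that $[\![ l]\!]_X=[\![ r]\!]_X$ for each equation $(l,r)\in E_A$, where terms are interpreted inductively using the interpretation of the operation symbols. The sequential lifting $\mathsf{op}^{\mathrm{seq}}:(D^\kappa X)^n\to D^\kappa X$ of an $n$-ary operation symbol is defined by guarded recursion: $$\mathsf{op}^{\mathrm{seq}}(\mathsf{now}\,x_1,\dots,\mathsf{now}\,x_n)=\mathsf{now}(\mathsf{op}_X(x_1,\dots,x_n)),$$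 $$\mathsf{op}^{\mathrm{seq}}(\mathsf{now}\,x_1,\dots,\mathsf{now}\,x_{i-1},\mathsf{step}\,u,y_{i+1},\dots,y_n)=\mathsf{step}(v),$$ where $v:\triangleright^\kappa(D^\kappa X)$ is, one tick later, $\mathsf{op}^{\mathrm{seq}}(\mathsf{now}\,x_1,\dots,\mathsf{now}\,x_{i-1},u',y_{i+1},\dots,y_n)$ (so the $i$-th argument is the first one that is a step). For a term $s$ in $m$ variables, $[\![ s]\!]^{\mathrm{seq}}:(D^\kappa X)^m\to D^\kappa X$ denotes its inductive interpretation using the sequential liftings of the operations. **Proposition.** Let $\kappa$ be a clock in a context $\Gamma$, let $A$ be an algebraic theory, let $X$ be a model of $A$ over $\Gamma$, and let $s,t$ be $A$-terms in $m$ variables such that $s=t$ is balanced and valid in $A$. Then $$[\![ s]\!]^{\mathrm{seq}}=[\![ t]\!]^{\mathrm{seq}} \quad\text{as maps } (D^\kappa X)^m\to D^\kappa X .$$ -/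

import Mathlib

open CategoryTheory

universe u u' v w

namespace Guarded

/-! ## Algebraic theories -/

/-- The first-order language whose function symbols are the given operation symbols (indexed by
arity) and which has no relation symbols. -/
def sig (Op : ℕ → Type u) : FirstOrder.Language := ⟨Op, fun _ => Empty⟩

/-- Terms over a signature in a context of `m` variables. -/
abbrev Tm (Op : ℕ → Type u) (m : ℕ) : Type u := (sig Op).Term (Fin m)

/-- An algebraic theory: operation symbols with finite arities, and equations, each of which is
a pair of terms in a finite variable context. -/
structure AlgTheory where
  /-- operation symbols of each arity -/
  Op : ℕ → Type u
  /-- (names of) the equations, indexed by the number of variables in the context -/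
  Eqn : ℕ → Type u'
  /-- left-hand side -/
  lhs : ∀ {n : ℕ}, Eqn n → Tm Op n
  /-- right-hand side -/
  rhs : ∀ {n : ℕ}, Eqn n → Tm Op n

/-- Validity of `s = t` in the theory `A`: the smallest congruence relation on terms that contains
all substitution instances of the equations of `A`. -/
inductive AlgTheory.Valid (A : AlgTheory.{u, u'}) {m : ℕ} : Tm A.Op m → Tm A.Op m → Prop
  | ax {n : ℕ} (e : A.Eqn n) (σ : Fin n → Tm A.Op m) :
      AlgTheory.Valid A ((A.lhs e).subst σ) ((A.rhs e).subst σ)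
  | refl (s : Tm A.Op m) : AlgTheory.Valid A s s
  | symm {s t : Tm A.Op m} : AlgTheory.Valid A s t → AlgTheory.Valid A t s
  | trans {r s t : Tm A.Op m} :
      AlgTheory.Valid A r s → AlgTheory.Valid A s t → AlgTheory.Valid A r t
  | congr {n : ℕ} (f : A.Op n) (ss ts : Fin n → Tm A.Op m) :
      (∀ i, AlgTheory.Valid A (ss i) (ts i)) →
        AlgTheory.Valid A (.func (L := sig A.Op) f ss) (.func (L := sig A.Op) f ts)

/-- The number of occurrences of the variable `x` in a term. -/
def occ {Op : ℕ → Type u} {m : ℕ} (x : Fin m) : Tm Op m → ℕ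
  | .var y => if y = x then 1 else 0
  | .func _ ts => ∑ i, occ x (ts i)

/-- The equation `s = t` is balanced: both sides have the same variables, and each of these
variables occurs equally many times in `s` and in `t`. -/
def Balanced {Op : ℕ → Type u} {m : ℕ} (s t : Tm Op m) : Prop :=
  s.varFinset = t.varFinset ∧ ∀ x ∈ s.varFinset ∪ t.varFinset, occ x s = occ x t

/-! ## Interpretation of terms in a type depending on a context

A type over a context is a functor `X : C ⥤ Type v`, with `C` the category of stages of the
context. -/

section Interp

variable {C : Type w} [Category.{0} C]

/-- The `n`-fold power `X ^ n`. -/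
@[simps]
def power (X : C ⥤ Type v) (n : ℕ) : C ⥤ Type v where
  obj c := Fin n → X.obj c
  map f := ↾fun ρ i => X.map f (ρ i)

/-- An interpretation of each `n`-ary operation symbol as a map `X ^ n ⟶ X`. -/
structure OpInterp (Op : ℕ → Type u) (X : C ⥤ Type v) where
  /-- the interpretation of an operation symbol -/
  op : ∀ {n : ℕ}, Op n → (power X n ⟶ X)

/-- The interpretation of a term with `m` variables as a map `X ^ m ⟶ X`, by induction on
the term. -/
def OpInterp.interp {Op : ℕ → Type u} {X : C ⥤ Type v} (I : OpInterp Op X) {m : ℕ} :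
    Tm Op m → (power X m ⟶ X)
  | .var i => { app := fun _ => ↾fun ρ => ρ i }
  | .func (f : Op _) ts =>
      { app := fun c => ↾fun ρ => (I.op f).app c fun j => (I.interp (ts j)).app c ρ
        naturality := by
          intro c d g
          ext ρ
          have h' : ∀ j, (I.interp (ts j)).app d ((power X m).map g ρ) =
              X.map g ((I.interp (ts j)).app c ρ) := fun j =>
            NatTrans.naturality_apply (I.interp (ts j)) g ρ
          change (I.op f).app d (fun j => (I.interp (ts j)).app d ((power X m).map g ρ)) =
            X.map g ((I.op f).app c fun j => (I.interp (ts j)).app c ρ)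
          simp only [h']
          exact NatTrans.naturality_apply (I.op f) g fun j => (I.interp (ts j)).app c ρ }

/-- `X` with the interpretation `I` is a model of the theory `A`: every equation of `A` holds. -/
def AlgTheory.IsModel (A : AlgTheory.{u, u'}) {X : C ⥤ Type v} (I : OpInterp A.Op X) : Prop :=
  ∀ {n : ℕ} (e : A.Eqn n), I.interp (A.lhs e) = I.interp (A.rhs e)

end Interp

/-! ## Multi-clocked guarded recursion -/

/-- A time object: a finite set of clock names, and for each of these clocks the (finite) number
of ticks that are left on it. -/
structure Time where
  /-- the clocks in use -/
  clocks : Finset ℕ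
  /-- the number of ticks left on each clock -/
  left : clocks → ℕ

/-- A morphism of time objects renames clocks (possibly identifying or adding some of them) and may
let time pass on each clock. -/
instance : Category.{0} Time where
  Hom S T := { σ : S.clocks → T.clocks // ∀ k, T.left (σ k) ≤ S.left k }
  id S := ⟨id, fun _ => le_rfl⟩
  comp f g := ⟨g.1 ∘ f.1, fun k => (g.2 (f.1 k)).trans (f.2 k)⟩

/-- The object of clocks. -/
def clk : Time ⥤ Type w where
  obj T := ULift.{w} T.clocks
  map f := ↾fun k => ⟨f.1 k.down⟩

/-- The time object `T` after one tick on the clock `k` (if there is one left). -/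
abbrev Time.tick (T : Time) (k : T.clocks) : Time :=
  ⟨T.clocks, Function.update T.left k (T.left k - 1)⟩

/-- Letting one tick pass. -/
def Time.next (T : Time) (k : T.clocks) : T ⟶ T.tick k :=
  ⟨id, fun j => by
    change Function.update T.left k (T.left k - 1) j ≤ T.left j
    by_cases h : j = k
    · subst h; simp
    · simp [h]⟩

theorem update_pred_le {α β : Type} [DecidableEq α] [DecidableEq β] (p : α → ℕ) (q : β → ℕ)
    (σ : α → β) (hσ : ∀ j, q (σ j) ≤ p j) (k : α) (j : α) :
    Function.update q (σ k) (q (σ k) - 1) (σ j) ≤ Function.update p k (p k - 1) j := by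
  have h1 := hσ j
  by_cases h : j = k
  · subst h; simp only [Function.update_self]; omega
  · by_cases h' : σ j = σ k
    · rw [Function.update_of_ne h, h', Function.update_self]
      rw [h'] at h1; omega
    · rwa [Function.update_of_ne h, Function.update_of_ne h']

/-- The tick operation is functorial. -/
def Time.tickMap {S T : Time} (f : S ⟶ T) {k : S.clocks} {l : T.clocks} (hk : f.1 k = l) :
    S.tick k ⟶ T.tick l :=
  ⟨f.1, by subst hk; exact update_pred_le S.left T.left f.1 f.2 k⟩

section Clock

/- A context `Γ`, with a clock `κ` in it. Types over `Γ` are functors on `Γ.Elements`. -/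
variable {Γ : Time ⥤ Type w} (κ : Γ ⟶ clk.{w})

/-- The clock `κ` at a stage of the context. -/
def clockAt (c : Γ.Elements) : c.1.clocks := (κ.app c.1 c.2).down

theorem clockAt_map {c d : Γ.Elements} (f : c ⟶ d) : f.1.1 (clockAt κ c) = clockAt κ d := by
  have h := NatTrans.naturality_apply κ f.1 c.2
  rw [f.2] at h
  exact (congrArg ULift.down h).symm

/-- The number of ticks left on `κ` at a stage. -/
def ticksLeft (c : Γ.Elements) : ℕ := c.1.left (clockAt κ c)

/-- The stage reached after one tick on `κ`. -/
def later (c : Γ.Elements) : Γ.Elements :=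
  ⟨c.1.tick (clockAt κ c), Γ.map (c.1.next (clockAt κ c)) c.2⟩

/-- The passage from a stage to the stage one tick later. -/
def toLater (c : Γ.Elements) : c ⟶ later κ c := ⟨c.1.next (clockAt κ c), rfl⟩

theorem ticksLeft_later (c : Γ.Elements) : ticksLeft κ (later κ c) = ticksLeft κ c - 1 := by
  have h : c.1.next (clockAt κ c) = (toLater κ c).1 := rfl
  have := clockAt_map κ (toLater κ c)
  unfold ticksLeft
  rw [← this]
  exact Function.update_self ..

theorem ticksLeft_anti {c d : Γ.Elements} (f : c ⟶ d) : ticksLeft κ d ≤ ticksLeft κ c := by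
  unfold ticksLeft
  rw [← clockAt_map κ f]
  exact f.1.2 _

/-- Passing to the stage one tick later is functorial. -/
def laterMap {c d : Γ.Elements} (f : c ⟶ d) : later κ c ⟶ later κ d :=
  ⟨Time.tickMap f.1 (clockAt_map κ f), by
    have h : c.1.next (clockAt κ c) ≫ Time.tickMap f.1 (clockAt_map κ f) =
        f.1 ≫ d.1.next (clockAt κ d) := rfl
    calc Γ.map (Time.tickMap f.1 (clockAt_map κ f)) (Γ.map (c.1.next (clockAt κ c)) c.2)
        = Γ.map (f.1 ≫ d.1.next (clockAt κ d)) c.2 := by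
          rw [← h]; exact (Γ.map_comp_apply _ _ _).symm
      _ = Γ.map (d.1.next (clockAt κ d)) d.2 :=
          (Γ.map_comp_apply _ _ _).trans (congrArg _ f.2)⟩

theorem toLater_comp_laterMap {c d : Γ.Elements} (f : c ⟶ d) :
    toLater κ c ≫ laterMap κ f = f ≫ toLater κ d := rfl

variable (X : Γ.Elements ⥤ Type v)

/-- The modality `▷`: an element of `▷ X` at a stage `c` is an element of `X` at the stage one tick
later, provided that there is a tick left on the clock (`▷ X` is a singleton at `c` otherwise). -/
def Later : Γ.Elements ⥤ Type v where
  obj c := 0 < ticksLeft κ c → X.obj (later κ c)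
  map f := ↾fun u h => X.map (laterMap κ f) (u (h.trans_le (ticksLeft_anti κ f)))
  map_id c := by
    ext u h
    exact X.map_id_apply (later κ c) _
  map_comp f g := by
    ext u h
    exact X.map_comp_apply (laterMap κ f) (laterMap κ g) _

/-- The elements at a stage of the guarded delay type, the guarded recursive type
`D X ≃ X + ▷ (D X)`. -/
inductive DelayAt : Γ.Elements → Type (max v w)
  | now {c : Γ.Elements} (a : X.obj c) : DelayAt c
  | step {c : Γ.Elements} (u : 0 < ticksLeft κ c → DelayAt (later κ c)) : DelayAt c

variable {X}

/-- The transition maps of the guarded delay type. -/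
def DelayAt.map {c : Γ.Elements} : DelayAt κ X c → ∀ {d : Γ.Elements}, (c ⟶ d) → DelayAt κ X d
  | .now a, _, f => .now (X.map f a)
  | .step u, _, f =>
      .step fun h => (u (h.trans_le (ticksLeft_anti κ f))).map (laterMap κ f)

theorem DelayAt.map_id {c : Γ.Elements} (x : DelayAt κ X c) : x.map κ (𝟙 c) = x := by
  induction x with
  | now a => exact congrArg DelayAt.now (X.map_id_apply _ a)
  | step u ih => exact congrArg DelayAt.step (funext fun h => ih h)

theorem DelayAt.map_comp {c : Γ.Elements} (x : DelayAt κ X c) {d e : Γ.Elements} (f : c ⟶ d)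
    (g : d ⟶ e) : x.map κ (f ≫ g) = (x.map κ f).map κ g := by
  induction x generalizing d e with
  | now a => exact congrArg DelayAt.now (X.map_comp_apply f g a)
  | step u ih => exact congrArg DelayAt.step (funext fun h => ih _ (laterMap κ f) (laterMap κ g))

variable (X)

/-- The guarded delay type `D X` on the clock `κ`. -/
def Delay : Γ.Elements ⥤ Type (max v w) where
  obj c := DelayAt κ X c
  map f := ↾fun x => x.map κ f
  map_id c := by ext x; exact x.map_id κ
  map_comp f g := by ext x; exact x.map_comp κ f g

/-- `D X` solves the guarded domain equation `D X ≃ X + ▷ (D X)`, naturally in the stage. -/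
def delayEquiv (c : Γ.Elements) : X.obj c ⊕ (Later κ (Delay κ X)).obj c ≃ (Delay κ X).obj c where
  toFun := Sum.elim DelayAt.now DelayAt.step
  invFun
    | .now a => .inl a
    | .step u => .inr u
  left_inv := by rintro (a | u) <;> rfl
  right_inv := by rintro (a | u) <;> rfl

theorem delayEquiv_inl_map {c d : Γ.Elements} (f : c ⟶ d) (a : X.obj c) :
    (Delay κ X).map f (delayEquiv κ X c (.inl a)) = delayEquiv κ X d (.inl (X.map f a)) := rfl

theorem delayEquiv_inr_map {c d : Γ.Elements} (f : c ⟶ d) (u : (Later κ (Delay κ X)).obj c) :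
    (Delay κ X).map f (delayEquiv κ X c (.inr u)) =
      delayEquiv κ X d (.inr ((Later κ (Delay κ X)).map f u)) := rfl

/-! ## Sequential lifting -/

variable {X}

/-- `x` is of the form `step u`. -/
def DelayAt.IsStep {c : Γ.Elements} : DelayAt κ X c → Prop
  | .now _ => False
  | .step _ => True

instance {c : Γ.Elements} (x : DelayAt κ X c) : Decidable (x.IsStep κ) :=
  match x with
  | .now _ => inferInstanceAs (Decidable False)
  | .step _ => inferInstanceAs (Decidable True)

/-- The value of an element that is not a step. -/
def DelayAt.value {c : Γ.Elements} : (x : DelayAt κ X c) → ¬ x.IsStep κ → X.obj c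
  | .now a, _ => a
  | .step _, h => (h trivial).elim

/-- Run an element for one tick: the argument of `step` if there is one to run, and a value is
simply kept. -/
def DelayAt.run {c : Γ.Elements} : DelayAt κ X c → 0 < ticksLeft κ c → DelayAt κ X (later κ c)
  | .now a, _ => .now (X.map (toLater κ c) a)
  | .step u, h => u h

variable {Op : ℕ → Type u} (I : OpInterp Op X)

/-- The sequential lifting of an `n`-ary operation, by guarded recursion: if all arguments are
values then the operation is applied to them, and otherwise the first argument that is a step is
run for one tick while the others are kept. -/
def seqLiftAt {n : ℕ} (f : Op n) (c : Γ.Elements) (x : Fin n → DelayAt κ X c) : DelayAt κ X c :=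
  if hx : ∃ i, (x i).IsStep κ then
    .step fun h => seqLiftAt f (later κ c) fun j =>
      if j = Fin.find (fun i => (x i).IsStep κ) hx then (x j).run κ h
      else (x j).map κ (toLater κ c)
  else .now ((I.op f).app c fun i => (x i).value κ fun hi => hx ⟨i, hi⟩)
termination_by ticksLeft κ c
decreasing_by rw [ticksLeft_later]; omega

theorem DelayAt.isStep_map {c d : Γ.Elements} (x : DelayAt κ X c) (g : c ⟶ d) :
    (x.map κ g).IsStep κ ↔ x.IsStep κ := by
  cases x <;> rfl

theorem DelayAt.value_map {c d : Γ.Elements} (x : DelayAt κ X c) (g : c ⟶ d)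
    (h : ¬ (x.map κ g).IsStep κ) (h' : ¬ x.IsStep κ) :
    (x.map κ g).value κ h = X.map g (x.value κ h') := by
  cases x with
  | now a => rfl
  | step u => exact (h' trivial).elim

theorem DelayAt.run_map {c d : Γ.Elements} (x : DelayAt κ X c) (g : c ⟶ d)
    (h : 0 < ticksLeft κ d) (h' : 0 < ticksLeft κ c) :
    (x.map κ g).run κ h = (x.run κ h').map κ (laterMap κ g) := by
  cases x with
  | now a =>
    refine congrArg DelayAt.now ?_
    calc X.map (toLater κ d) (X.map g a) = X.map (g ≫ toLater κ d) a :=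
          (X.map_comp_apply _ _ _).symm
      _ = X.map (toLater κ c ≫ laterMap κ g) a := rfl
      _ = X.map (laterMap κ g) (X.map (toLater κ c) a) := X.map_comp_apply _ _ _
  | step u => rfl

theorem seqLiftAt_map {n : ℕ} (f : Op n) {c d : Γ.Elements} (x : Fin n → DelayAt κ X c)
    (g : c ⟶ d) :
    seqLiftAt κ I f d (fun i => (x i).map κ g) = (seqLiftAt κ I f c x).map κ g := by
  induction hk : ticksLeft κ c using Nat.strong_induction_on generalizing c d with
  | _ k ih =>
    rw [seqLiftAt, seqLiftAt]
    have hp : (fun i => ((x i).map κ g).IsStep κ) = fun i => (x i).IsStep κ :=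
      funext fun i => propext ((x i).isStep_map κ g)
    by_cases hx : ∃ i, (x i).IsStep κ
    · have hx' : ∃ i, ((x i).map κ g).IsStep κ := by
        simpa only [DelayAt.isStep_map] using hx
      rw [dif_pos hx, dif_pos hx']
      refine congrArg DelayAt.step (funext fun h => ?_)
      have hc := h.trans_le (ticksLeft_anti κ g)
      refine Eq.trans ?_ (ih _ (by rw [ticksLeft_later]; omega) _ (laterMap κ g) rfl)
      refine congrArg _ (funext fun j => ?_)
      have hf : Fin.find (fun i => ((x i).map κ g).IsStep κ) hx' =
          Fin.find (fun i => (x i).IsStep κ) hx := by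
        simp only [DelayAt.isStep_map]
      rw [hf]
      split_ifs
      · exact (x j).run_map κ g h hc
      · rw [← DelayAt.map_comp, ← DelayAt.map_comp, toLater_comp_laterMap]
    · have hx' : ¬ ∃ i, ((x i).map κ g).IsStep κ := by
        simpa only [DelayAt.isStep_map] using hx
      rw [dif_neg hx, dif_neg hx']
      refine congrArg DelayAt.now ?_
      refine Eq.trans ?_ (NatTrans.naturality_apply (I.op f) g _)
      exact congrArg _ (funext fun i => (x i).value_map κ g _ _)

/-- The interpretation of the operation symbols on `D X` by sequential lifting. -/
def seqLift : OpInterp Op (Delay κ X) where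
  op f :=
    { app := fun c => ↾fun x => seqLiftAt κ I f c x
      naturality := by
        intro c d g
        ext x
        exact seqLiftAt_map κ I f x g }

end Clock
end Guarded

namespace Guarded

/-! ## Soundness -/

section Soundness

variable {C : Type w} [Category.{0} C] {Op : ℕ → Type u} {X : C ⥤ Type v} (I : OpInterp Op X)

/-! An element of the delay type amounts to a number `n` of steps followed by a value that exists
only once `n` ticks have passed (`exists_eq_steps`). Sequential lifting runs one argument at a time,
so delays add up and the values are combined at the end by the operation of `X` (`seqLiftAt_steps`).
Hence a term on inputs with delays `n j` takes `∑ j, occ j s * n j` steps and returns its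
interpretation in `X` (`interp_seqLift_steps`). Balance makes the two step counts agree, and
validity makes the returned values agree (`AlgTheory.Valid.sound`). -/

theorem OpInterp.interp_subst {m n : ℕ} (s : Tm Op n) (σ : Fin n → Tm Op m) (c : C)
    (ρ : Fin m → X.obj c) :
    (I.interp (s.subst σ)).app c ρ = (I.interp s).app c fun i => (I.interp (σ i)).app c ρ := by
  induction s with
  | var i => rfl
  | func f ts ih =>
    exact congrArg ((I.op f).app c) (funext ih)

theorem AlgTheory.Valid.sound {A : AlgTheory.{u, u'}} {I : OpInterp A.Op X} (hX : A.IsModel I)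
    {m : ℕ} {s t : Tm A.Op m} (h : A.Valid s t) : I.interp s = I.interp t := by
  induction h with
  | ax e σ =>
    ext c ρ
    exact (I.interp_subst _ σ c ρ).trans
      ((congrArg (fun k : power X _ ⟶ X => k.app c fun i => (I.interp (σ i)).app c ρ) (hX e)).trans
        (I.interp_subst _ σ c ρ).symm)
  | refl => rfl
  | symm _ ih => exact ih.symm
  | trans _ _ ih₁ ih₂ => exact ih₁.trans ih₂
  | congr f ss ts _ ih =>
    ext c ρ
    exact congrArg ((I.op f).app c)
      (funext fun j => congrArg (fun k : power X _ ⟶ X => k.app c ρ) (ih j))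

end Soundness

/-! ## Occurrences -/

theorem occ_eq_zero {Op : ℕ → Type u} {m : ℕ} {x : Fin m} (s : Tm Op m)
    (hx : x ∉ s.varFinset) : occ x s = 0 := by
  induction s with
  | var y =>
    rw [FirstOrder.Language.Term.varFinset, Finset.mem_singleton] at hx
    exact if_neg (Ne.symm hx)
  | func f ts ih =>
    rw [FirstOrder.Language.Term.varFinset, Finset.mem_biUnion] at hx
    exact Finset.sum_eq_zero fun i _ => ih i fun h => hx ⟨i, Finset.mem_univ i, h⟩

/-- Removes the restriction to occurring variables, so that sums over all of `Fin m` can be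
compared. -/
theorem Balanced.occ_eq {Op : ℕ → Type u} {m : ℕ} {s t : Tm Op m} (h : Balanced s t)
    (x : Fin m) : occ x s = occ x t := by
  by_cases hx : x ∈ s.varFinset ∪ t.varFinset
  · exact h.2 x hx
  · rw [Finset.mem_union, not_or] at hx
    rw [occ_eq_zero s hx.1, occ_eq_zero t hx.2]

/-! ## Delayed values -/

section Steps

variable {Γ : Time ⥤ Type w} (κ : Γ ⟶ clk.{w}) (X : Γ.Elements ⥤ Type v)

/-- A value of `X` available `n` ticks after the stage `c`: a compatible family of elements of `X`
at the stages under `c` at which at least `n` ticks of the clock have been used up. -/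
structure Delayed (n : ℕ) (c : Γ.Elements) where
  /-- the value at a stage under `c` -/
  val : ∀ d : Γ.Elements, (c ⟶ d) → ticksLeft κ d + n ≤ ticksLeft κ c → X.obj d
  /-- the values are compatible -/
  map_val : ∀ (d e : Γ.Elements) (f : c ⟶ d) (g : d ⟶ e) (hd : ticksLeft κ d + n ≤ ticksLeft κ c)
    (he : ticksLeft κ e + n ≤ ticksLeft κ c), X.map g (val d f hd) = val e (f ≫ g) he

variable {X}

/-- Restriction of a delayed value to a later stage. -/
def Delayed.map {n : ℕ} {c d : Γ.Elements} (a : Delayed κ X n c) (g : c ⟶ d) :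
    Delayed κ X n d where
  val e f h := a.val e (g ≫ f) (h.trans (ticksLeft_anti κ g))
  map_val d' e f f' hd he := by
    rw [a.map_val d' e (g ≫ f) f' _ (he.trans (ticksLeft_anti κ g))]
    simp only [Category.assoc]

/-- A delayed value one tick later. -/
def Delayed.tail {n : ℕ} {c : Γ.Elements} (a : Delayed κ X (n + 1) c)
    (hc : 0 < ticksLeft κ c) : Delayed κ X n (later κ c) where
  val e f h := a.val e (toLater κ c ≫ f) (by rw [ticksLeft_later] at h; omega)
  map_val d e f g hd he := by
    rw [a.map_val d e (toLater κ c ≫ f) g _ (by rw [ticksLeft_later] at he; omega)]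
    simp only [Category.assoc]

/-- The element of the guarded delay type that takes `n` steps and then returns a given value. -/
def steps : ∀ (n : ℕ) {c : Γ.Elements}, Delayed κ X n c → DelayAt κ X c
  | 0, c, a => .now (a.val c (𝟙 c) le_rfl)
  | n + 1, _, a => .step fun h => steps n (a.tail κ h)

/-- Restriction never consumes a step, even when ticks pass along `g`. Thus the arguments that are
not run keep their full delay, which is why delays add instead of overlapping. -/
theorem steps_map (n : ℕ) {c d : Γ.Elements} (a : Delayed κ X n c) (g : c ⟶ d) :
    (steps κ n a).map κ g = steps κ n (a.map κ g) := by
  induction n generalizing c d with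
  | zero =>
    refine congrArg DelayAt.now ?_
    rw [a.map_val c d (𝟙 c) g _ (ticksLeft_anti κ g)]
    simp only [Delayed.map, Category.id_comp, Category.comp_id]
  | succ n ih =>
    exact congrArg DelayAt.step (funext fun h => ih _ (laterMap κ g))

theorem steps_isStep (n : ℕ) {c : Γ.Elements} (a : Delayed κ X n c) :
    (steps κ n a).IsStep κ ↔ n ≠ 0 := by
  cases n with
  | zero => exact ⟨False.elim, fun h => h rfl⟩
  | succ n => exact ⟨fun _ => n.succ_ne_zero, fun _ => trivial⟩

theorem exists_run_steps {n : ℕ} {c : Γ.Elements} (a : Delayed κ X n c) (hn : n ≠ 0)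
    (h : 0 < ticksLeft κ c) :
    ∃ (q : ℕ) (b : Delayed κ X q (later κ c)), q + 1 = n ∧
      (steps κ n a).run κ h = steps κ q b ∧
      ∀ d g h₁ h₂, b.val d g h₁ = a.val d (toLater κ c ≫ g) h₂ := by
  cases n with
  | zero => exact (hn rfl).elim
  | succ q => exact ⟨q, a.tail κ h, rfl, rfl, fun _ _ _ _ => rfl⟩

/-- A passage to a stage with fewer ticks on the clock factors through the stage one tick later. -/
def ofLater {c d : Γ.Elements} (f : c ⟶ d) (h : ticksLeft κ d < ticksLeft κ c) :
    later κ c ⟶ d :=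
  ⟨⟨f.1.1, fun j => by
    change _ ≤ Function.update c.1.left (clockAt κ c) (c.1.left (clockAt κ c) - 1) j
    by_cases hj : j = clockAt κ c
    · subst hj
      rw [Function.update_self, clockAt_map κ f]
      exact Nat.le_pred_of_lt h
    · exact (f.1.2 j).trans_eq (Function.update_of_ne hj _ _).symm⟩, by
    exact (Γ.map_comp_apply _ _ _).symm.trans f.2⟩

/-- The number `n` need not be unique: once it exceeds the ticks left, the family of values is empty
and `x` never returns. -/
theorem exists_eq_steps {c : Γ.Elements} (x : DelayAt κ X c) :
    ∃ (n : ℕ) (a : Delayed κ X n c), x = steps κ n a := by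
  induction x with
  | @now c a =>
    refine ⟨0, ⟨fun d f _ => X.map f a, fun d e f g _ _ => (X.map_comp_apply f g a).symm⟩, ?_⟩
    exact congrArg DelayAt.now (X.map_id_apply c a).symm
  | @step c u ih =>
    by_cases hc : 0 < ticksLeft κ c
    · obtain ⟨n, a, ha⟩ := ih hc
      -- At a stage where `n + 1` ticks are used up, the map from `c` factors through the next
      -- stage, where `a` lives. Taking `Delayed.tail` gives back `a` definitionally.
      refine ⟨n + 1, ⟨fun d f h => a.val d (ofLater κ f (by omega))
        (by rw [ticksLeft_later]; omega), fun d e f g hd he => ?_⟩, ?_⟩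
      · exact a.map_val d e (ofLater κ f (by omega)) g _ (by rw [ticksLeft_later]; omega)
      · exact congrArg DelayAt.step (funext fun h => ha)
    -- With no tick left, every step is the same element and no value is ever demanded; any positive
    -- count would do.
    · refine ⟨1, ⟨fun d f h => (hc (by omega)).elim, fun d e f g hd he => (hc (by omega)).elim⟩, ?_⟩
      exact congrArg DelayAt.step (funext fun h => (hc h).elim)

/-! ## Sequential lifting of operations and terms on delayed values -/

variable {Op : ℕ → Type u} (I : OpInterp Op X)

/-- An operation applied to delayed values, which is available once all delays have passed. -/
def Delayed.app {k : ℕ} (f : Op k) {c : Γ.Elements} {n : Fin k → ℕ}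
    (a : ∀ i, Delayed κ X (n i) c) (N : ℕ) (hn : ∀ i, n i ≤ N) : Delayed κ X N c where
  val d g h := (I.op f).app d fun i =>
    (a i).val d g ((Nat.add_le_add_left (hn i) _).trans h)
  map_val d e g g' hd he := by
    refine (NatTrans.naturality_apply (I.op f) g' _).symm.trans ?_
    exact congrArg _ (funext fun i => (a i).map_val d e g g' _ _)

/-- Each tick lowers exactly one delay by one, so the total drops by one whichever argument is run.
This gives an induction on the total. -/
theorem seqLiftAt_steps {k : ℕ} (f : Op k) (N : ℕ) {c : Γ.Elements} {n : Fin k → ℕ}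
    (a : ∀ i, Delayed κ X (n i) c) (hN : ∑ i, n i = N) (hn : ∀ i, n i ≤ N) :
    seqLiftAt κ I f c (fun i => steps κ (n i) (a i)) =
      steps κ N (Delayed.app κ I f a N hn) := by
  induction N generalizing c n with
  | zero =>
    obtain rfl : n = fun _ => 0 := funext fun i => Nat.le_zero.mp (hn i)
    rw [seqLiftAt, dif_neg fun ⟨i, hi⟩ => (steps_isStep κ 0 (a i)).mp hi rfl]
    rfl
  | succ N ih =>
    have hx : ∃ i, (steps κ (n i) (a i)).IsStep κ := by
      by_contra! hx
      simp only [steps_isStep, not_not] at hx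
      simp [hx] at hN
    rw [seqLiftAt, dif_pos hx]
    refine congrArg DelayAt.step (funext fun h => ?_)
    have hi₀ := Fin.find_spec hx
    -- Only that the chosen argument is a step matters, not that it is the first one.
    generalize Fin.find (fun i => (steps κ (n i) (a i)).IsStep κ) hx = i₀ at hi₀ ⊢
    -- the delays and the delayed values one tick later
    have key : ∀ j, ∃ (q : ℕ) (b : Delayed κ X q (later κ c)),
        q + (if j = i₀ then 1 else 0) = n j ∧
        (if j = i₀ then (steps κ (n j) (a j)).run κ h
          else (steps κ (n j) (a j)).map κ (toLater κ c)) = steps κ q b ∧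
        ∀ d g h₁ h₂, b.val d g h₁ = (a j).val d (toLater κ c ≫ g) h₂ := by
      intro j
      by_cases hj : j = i₀
      · subst hj
        simp only [if_true]
        exact exists_run_steps κ (a j) ((steps_isStep κ _ _).mp hi₀) h
      · simp only [if_neg hj]
        exact ⟨n j, (a j).map κ (toLater κ c), rfl, steps_map κ _ _ _, fun _ _ _ _ => rfl⟩
    choose q b hq hb hv using key
    have hsum : ∑ j, q j = N := by
      have : ∑ j, (q j + if j = i₀ then 1 else 0) = N + 1 := by simp only [hq, hN]
      rw [Finset.sum_add_distrib, Finset.sum_ite_eq' Finset.univ i₀, if_pos (Finset.mem_univ _)]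
        at this
      omega
    have hle : ∀ j, q j ≤ N := fun j =>
      hsum ▸ Finset.single_le_sum (fun _ _ => Nat.zero_le _) (Finset.mem_univ j)
    simp only [hb]
    rw [ih b hsum hle]
    congr 1
    refine Delayed.mk.injEq .. |>.mpr ?_
    funext d g hd
    exact congrArg ((I.op f).app d) (funext fun j => hv j d g _ _)

/-- A variable absent from `s` contributes no delay, so its value may be unavailable when the result
is. The valuation `v` is therefore constrained only at available variables, which include all those
occurring in `s`. -/
theorem interp_seqLift_steps {m : ℕ} (s : Tm Op m) {c : Γ.Elements} (n : Fin m → ℕ)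
    (a : ∀ i, Delayed κ X (n i) c) :
    ∃ b : Delayed κ X (∑ j, occ j s * n j) c,
      ((seqLift κ I).interp s).app c (fun i => steps κ (n i) (a i)) = steps κ _ b ∧
      ∀ d g h (v : Fin m → X.obj d), (∀ j hj, v j = (a j).val d g hj) →
        b.val d g h = (I.interp s).app d v := by
  induction s with
  | var i =>
    have hi : ∑ j, occ j (.var i : Tm Op m) * n j = n i := by simp [occ]
    rw [hi]
    exact ⟨a i, rfl, fun d g h v hv => (hv i h).symm⟩
  | @func k f ts ih =>
    choose b hb hv using ih
    have hs : ∑ i, ∑ j, occ j (ts i) * n j =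
        ∑ j, occ j (.func (L := sig Op) f ts) * n j := by
      rw [Finset.sum_comm]
      simp only [occ, Finset.sum_mul]
    have hle : ∀ i, ∑ j, occ j (ts i) * n j ≤ ∑ j, occ j (.func (L := sig Op) f ts) * n j :=
      fun i => hs ▸ Finset.single_le_sum (f := fun i => ∑ j, occ j (ts i) * n j)
        (fun _ _ => Nat.zero_le _) (Finset.mem_univ i)
    refine ⟨Delayed.app κ I f b _ hle, ?_, fun d g h v hva => ?_⟩
    · refine Eq.trans ?_ (seqLiftAt_steps κ I f _ b hs hle)
      exact congrArg (seqLiftAt κ I f c) (funext hb)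
    · exact congrArg ((I.op f).app d) (funext fun i => hv i d g _ v hva)

end Steps

end Guarded

theorem proposition5p4 {Γ : Guarded.Time ⥤ Type w} (κ : Γ ⟶ Guarded.clk.{w})
    (A : Guarded.AlgTheory.{u, u'}) (X : Γ.Elements ⥤ Type v)
    (I : Guarded.OpInterp A.Op X) (hX : A.IsModel I)
    {m : ℕ} (s t : Guarded.Tm A.Op m) (hbal : Guarded.Balanced s t) (hst : A.Valid s t) :
    (Guarded.seqLift κ I).interp s = (Guarded.seqLift κ I).interp t := by
  ext c ρ
  choose n a ha using fun i => Guarded.exists_eq_steps κ (ρ i)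
  obtain rfl : ρ = fun i => Guarded.steps κ (n i) (a i) := funext ha
  have hS := Guarded.interp_seqLift_steps κ I s n a
  -- The step count is an index of the type of `b`, so it is rewritten before unpacking; `bs` and
  -- `bt` then have the same type.
  rw [Finset.sum_congr rfl fun j _ => congrArg (· * n j) (hbal.occ_eq j)] at hS
  obtain ⟨bs, hs, hvs⟩ := hS
  obtain ⟨bt, ht, hvt⟩ := Guarded.interp_seqLift_steps κ I t n a
  refine hs.trans (Eq.trans ?_ ht.symm)
  congr 1
  refine Guarded.Delayed.mk.injEq .. |>.mpr ?_
  -- Soundness needs one valuation of all `m` variables, since a derivation of `s = t` may pass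
  -- through variables that occur in neither side.
  funext d g h
  -- variables whose value is not available do not matter, but need some value
  let v : Fin m → X.obj d := fun j =>
    if hj : Guarded.ticksLeft κ d + n j ≤ Guarded.ticksLeft κ c then (a j).val d g hj
    else bt.val d g h
  have hv : ∀ j hj, v j = (a j).val d g hj := fun j hj => dif_pos hj
  rw [hvs d g h v hv, hvt d g h v hv, hst.sound hX]
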